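/- Conventions. Let $\mathcal S$ be a triangulated category with suspension $\Sigma$. A good metric on $\mathcal S$ is a sequence $\{\mathcal M_i\}_{i\in\mathbb N}$ of full subcategories, each containing $0$, such that $\mathcal M_i*\mathcal M_i\subset\mathcal M_i$ (if $b\to x\to b'\to\Sigma b$ is a distinguished triangle with $b,b'\in\mathcal M_i$ then $x\in\mathcal M_i$) and $\Sigma^{-1}\mathcal M_{i+1}\cup\mathcal M_{i+1}\cup\Sigma\mathcal M_{i+1}\subset\mathcal M_i$. Put ${}^\perp\mathcal M=\{x:\operatorname{Hom}(x,y)=0\text{ for all }y\in\mathcal M\}$. The metric is very good if moreover $\mathcal S=\bigcup_i{}^\perp\mathcal M_i$, and for every $m$ there is $n>m$ such that every $X\in\mathcal S$ admits a distinguished triangle $E\to X\to D\to\Sigma E$ with $E\in{}^\perp\mathcal M_n$ and $D\in\mathcal M_m$. A sequence $x_0\to x_1\to\cdots$ in $\mathcal S$ is Cauchy if for every $i$ there is $N$ such that for $m'\ge m\ge N$ the cone of $x_m\to x_{m'}$ lies in $\mathcal M_i$. A Cauchy sequence of triangles is a sequence of distinguished triangles $a_*\to b_*\to c_*\to\Sigma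 a_*$ in $\mathcal S$, with morphisms of triangles between consecutive terms, such that $a_*,b_*,c_*$ are Cauchy. Let $Y:\mathcal S\to\mathrm{Mod}\text{-}\mathcal S$, $s\mapsto\operatorname{Hom}(-,s)$, be the Yoneda functor into additive functors $\mathcal S^{op}\to Ab$. For a triangulated functor $F:\mathcal S\to\mathcal T$ let $\mathcal Y:\mathcal T\to\mathrm{Mod}\text{-}\mathcal S$, $t\mapsto\operatorname{Hom}(F(-),t)$. A fully faithful triangulated functor $F:\mathcal S\to\mathcal T$ is a good extension with respect to the metric if for every Cauchy sequence $x_*$ in $\mathcal S$ the coproduct $\coprod_n F(x_n)$ exists in $\mathcal T$ and the natural map $\operatorname{colim}Y(x_*)\to\mathcal Y(\operatorname{hocolim}F(x_*))$ is an isomorphism, where $\operatorname{hocolim}F(x_*)$ is the cone of $\mathrm{id}-\mathrm{shift}:\coprod_nF(x_n)\to\coprod_nF(x_n)$. Let $\mathfrak L'(\mathcal S)\subset\mathcal T$ be the full subcategory of objects isomorphic to $\operatorname{hocolim}F(x_*)$ for some Cauchy sequence $x_*$ in $\mathcal S$. Proposition. Let $\{\mathcal M_i\}$ be a very good metric on the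 triangulated category $\mathcal S$, with each $\mathcal M_i$ closed in $\mathcal S$ under direct summands, and let $F:\mathcal S\to\mathcal T$ be a good extension with respect to the metric. Then $\mathfrak L'(\mathcal S)$ is a triangulated subcategory of $\mathcal T$. Moreover, let $\varphi:A\to B$ be a morphism in $\mathfrak L'(\mathcal S)$, let $a_*,b_*$ be Cauchy sequences in $\mathcal S$ with isomorphisms $A\cong\operatorname{hocolim}F(a_*)$ and $B\cong\operatorname{hocolim}F(b_*)$, and let $\alpha:F(a_*)\to A$ and $\beta:F(b_*)\to B$ be the resulting maps. Then, after passing to subsequences of $a_*$ and $b_*$, there is a map of sequences $\varphi_*:a_*\to b_*$ with $\operatorname{colim}Y(\varphi_*)=\mathcal Y(\varphi)$ (under the identifications $\operatorname{colim}Y(a_*)\cong\mathcal Y(A)$ and $\operatorname{colim}Y(b_*)\cong\mathcal Y(B)$). For every such $\varphi_*$ and every distinguished triangle $A\xrightarrow{\varphi}B\to C\to\Sigma A$ in $\mathcal T$ one can, after passing to a further subsequence, complete $\varphi_*$ in $\mathcal S$ to a Cauchy sequence of triangles $a_*\xrightarrow{\varphi_*}b_*\to c_*\to\Sigma a_*$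 in such a way that: (iv) the commutative square formed by $F(\varphi_*),\alpha,\beta,\varphi$ extends to a commutative diagram in $\mathcal T$, from $F(a_*)\to F(b_*)\to F(c_*)\to\Sigma F(a_*)$ to $A\to B\to C\to\Sigma A$, with vertical maps $\alpha,\beta,\gamma,\Sigma\alpha$ for some $\gamma:F(c_*)\to C$; (v) $\gamma$ is the composite of the canonical map $F(c_*)\to\operatorname{hocolim}F(c_*)$ with an isomorphism $\operatorname{hocolim}F(c_*)\cong C$, and the maps induced by $\alpha,\beta,\gamma,\Sigma\alpha$ form an isomorphism in $\mathrm{Mod}\text{-}\mathcal S$ from the strong triangle $\operatorname{colim}Y(a_*)\to\operatorname{colim}Y(b_*)\to\operatorname{colim}Y(c_*)\to\operatorname{colim}Y(\Sigma a_*)$ to the sequence $\mathcal Y(A)\to\mathcal Y(B)\to\mathcal Y(C)\to\mathcal Y(\Sigma A)$. -/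

import Mathlib

universe v u u'

open CategoryTheory CategoryTheory.Limits CategoryTheory.Pretriangulated Opposite

noncomputable section

namespace MetricTriangulated

section Sequences

variable {C : Type u} [Category.{v} C]

/-- The subsequence `E (ρ 0) ⟶ E (ρ 1) ⟶ ⋯` of a sequence `E 0 ⟶ E 1 ⟶ ⋯`. -/
def subseq (E : ℕ ⥤ C) {ρ : ℕ → ℕ} (hρ : StrictMono ρ) : ℕ ⥤ C :=
  hρ.monotone.functor ⋙ E

/-- A map of sequences restricts to subsequences. -/
def subseqMap {E E' : ℕ ⥤ C} (f : E ⟶ E') {ρ : ℕ → ℕ} (hρ : StrictMono ρ) :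
    subseq E hρ ⟶ subseq E' hρ :=
  Functor.whiskerLeft hρ.monotone.functor f

end Sequences

section Metric

variable {S : Type u} [Category.{v} S] [Preadditive S] [HasZeroObject S] [HasShift S ℤ]
  [∀ n : ℤ, (shiftFunctor S n).Additive] [Pretriangulated S]

/-- A good metric on a triangulated category: full subcategories `M i` containing `0`, with
`M i * M i ⊆ M i` and `Σ⁻¹ M (i+1) ∪ M (i+1) ∪ Σ M (i+1) ⊆ M i`.
(Such `M i` are automatically closed under isomorphisms.) -/
structure IsGoodMetric (M : ℕ → ObjectProperty S) : Prop where
  containsZero : ∀ i, (M i).ContainsZero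
  ext : ∀ (i : ℕ) (D : Triangle S), D ∈ distTriang S → M i D.obj₁ → M i D.obj₃ → M i D.obj₂
  le : ∀ (i : ℕ) (X : S), M (i + 1) X → M i X
  shift : ∀ (i : ℕ) (X : S), M (i + 1) X → M i (X⟦(1 : ℤ)⟧)
  shift_neg : ∀ (i : ℕ) (X : S), M (i + 1) X → M i (X⟦(-1 : ℤ)⟧)

/-- A very good metric: a good metric such that every object lies in some `⊥(M i)`, and for every
`m` there is `n > m` such that every object `X` sits in a triangle `E ⟶ X ⟶ D ⟶ ΣE` with
`E ∈ ⊥(M n)` and `D ∈ M m`. -/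
structure IsVeryGoodMetric (M : ℕ → ObjectProperty S) : Prop extends IsGoodMetric M where
  exists_leftOrthogonal : ∀ X : S, ∃ i, (M i).leftOrthogonal X
  exists_triangle : ∀ m : ℕ, ∃ n, m < n ∧ ∀ X : S, ∃ (E D : S) (p : E ⟶ X) (q : X ⟶ D)
    (r : D ⟶ E⟦(1 : ℤ)⟧), Triangle.mk p q r ∈ distTriang S ∧ (M n).leftOrthogonal E ∧ M m D

/-- Cauchy sequences: for every `i`, the cones of `E m ⟶ E m'` lie in `M i` for all large
`m ≤ m'`. -/
def IsCauchy (M : ℕ → ObjectProperty S) (E : ℕ ⥤ S) : Prop :=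
  ∀ i : ℕ, ∃ N : ℕ, ∀ (m m' : ℕ) (h : m ≤ m'), N ≤ m →
    ∀ (D : S) (q : E.obj m' ⟶ D) (r : D ⟶ (E.obj m)⟦(1 : ℤ)⟧),
      Triangle.mk (E.map (homOfLE h)) q r ∈ distTriang S → M i D

/-- A Cauchy sequence of triangles `a ⟶ b ⟶ c ⟶ Σa`: a sequence of distinguished triangles, and
morphisms of triangles between them, whose three sequences of objects are Cauchy. -/
structure IsCauchySeqOfTriangles (M : ℕ → ObjectProperty S) {a b c : ℕ ⥤ S}
    (f : a ⟶ b) (g : b ⟶ c) (h : c ⟶ a ⋙ shiftFunctor S (1 : ℤ)) : Prop where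
  cauchy₁ : IsCauchy M a
  cauchy₂ : IsCauchy M b
  cauchy₃ : IsCauchy M c
  distinguished : ∀ n, Triangle.mk (f.app n) (g.app n) (h.app n) ∈ distTriang S

/-- `α : E ⟶ X` exhibits `X` as a homotopy colimit of the sequence `E`: the coproduct of the `E n`
exists, and there is a distinguished triangle
`∐ E n --(id - shift)--> ∐ E n --(α n)--> X ⟶ Σ (∐ E n)`.
Equivalently, `α` is the canonical map `E ⟶ hocolim E` followed by an isomorphism
`hocolim E ≅ X`. -/
def IsHocolim (E : ℕ ⥤ S) {X : S} (α : E ⟶ (Functor.const ℕ).obj X) : Prop :=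
  ∃ (c : Cofan E.obj) (hc : IsColimit c) (δ : X ⟶ c.pt⟦(1 : ℤ)⟧),
    Triangle.mk
      (𝟙 c.pt - Cofan.IsColimit.desc hc (fun n => E.map (homOfLE n.le_succ) ≫ c.inj (n + 1)))
      (Cofan.IsColimit.desc hc (fun n => α.app n)) δ ∈ distTriang S

end Metric

section Yoneda

variable {S : Type u} [Category.{v} S] [Preadditive S]

/-- The Yoneda functor `Y : S ⥤ Mod-S`, `s ↦ Hom(-, s)`. We compute in the category of all
functors `Sᵒᵖ ⥤ Ab`; the additive ones form a full subcategory, containing the image of `Y` and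
closed under colimits. -/
abbrev Y (S : Type u) [Category.{v} S] [Preadditive S] : S ⥤ Sᵒᵖ ⥤ AddCommGrpCat.{v} :=
  preadditiveYoneda

variable {T : Type u'} [Category.{v} T] [Preadditive T] (F : S ⥤ T)

/-- The restricted Yoneda functor `𝒴 : T ⥤ Mod-S`, `t ↦ Hom(F(-), t)`. -/
def restrictedYoneda : T ⥤ Sᵒᵖ ⥤ AddCommGrpCat.{v} :=
  preadditiveYoneda ⋙ (Functor.whiskeringLeft _ _ _).obj F.op

variable [F.Additive]

/-- The canonical map `Y(s) ⟶ 𝒴(F(s))`, given by `F : Hom(-, s) ⟶ Hom(F(-), F(s))`. -/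
def yonedaComparison (s : S) : (Y S).obj s ⟶ (restrictedYoneda F).obj (F.obj s) :=
  preadditiveYonedaMap F s

lemma yonedaComparison_naturality {s t : S} (f : s ⟶ t) :
    (Y S).map f ≫ yonedaComparison F t =
      yonedaComparison F s ≫ (restrictedYoneda F).map (F.map f) := by
  have key : ∀ (r : S) (x : r ⟶ s), F.map (x ≫ f) = F.map x ≫ F.map f :=
    fun r x => F.map_comp x f
  ext r x
  exact key r.unop x

/-- The cocone on `Y(E)` with vertex `𝒴(X)` induced by `α : F(E) ⟶ X`. -/
def yonedaCocone {E : ℕ ⥤ S} {X : T} (α : E ⋙ F ⟶ (Functor.const ℕ).obj X) :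
    Cocone (E ⋙ Y S) where
  pt := (restrictedYoneda F).obj X
  ι :=
    { app := fun n => yonedaComparison F (E.obj n) ≫ (restrictedYoneda F).map (α.app n)
      naturality := by
        intro m n f
        have h : F.map (E.map f) ≫ α.app n = α.app m :=
          (α.naturality f).trans (Category.comp_id _)
        refine Eq.trans ?_ (Category.comp_id _).symm
        rw [← h, Functor.map_comp, Functor.comp_map, ← Category.assoc,
          yonedaComparison_naturality, Category.assoc] }

/-- The natural map `colim Y(E) ⟶ 𝒴(X)` induced by `α : F(E) ⟶ X`. -/
def colimYonedaDesc {E : ℕ ⥤ S} {X : T} (α : E ⋙ F ⟶ (Functor.const ℕ).obj X) :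
    colimit (E ⋙ Y S) ⟶ (restrictedYoneda F).obj X :=
  colimit.desc (E ⋙ Y S) (yonedaCocone F α)

/-- The map `colim Y(f) : colim Y(E) ⟶ colim Y(E')` induced by a map of sequences. -/
def colimYonedaMap {E E' : ℕ ⥤ S} (f : E ⟶ E') : colimit (E ⋙ Y S) ⟶ colimit (E' ⋙ Y S) :=
  colimMap (Functor.whiskerRight f (Y S))

/-- The equality `colim Y(f) = 𝒴(φ)`, where `colim Y(E)` is compared with `𝒴(X)` and `colim Y(E')`
with `𝒴(X')` through the natural maps. -/
def ColimYonedaEq {E E' : ℕ ⥤ S} {X X' : T} (α : E ⋙ F ⟶ (Functor.const ℕ).obj X)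
    (α' : E' ⋙ F ⟶ (Functor.const ℕ).obj X') (f : E ⟶ E') (φ : X ⟶ X') : Prop :=
  colimYonedaMap f ≫ colimYonedaDesc F α' = colimYonedaDesc F α ≫ (restrictedYoneda F).map φ

end Yoneda

section GoodExtension

variable {S : Type u} [Category.{v} S] [Preadditive S] [HasZeroObject S] [HasShift S ℤ]
  [∀ n : ℤ, (shiftFunctor S n).Additive] [Pretriangulated S]
  {T : Type u'} [Category.{v} T] [Preadditive T] [HasZeroObject T] [HasShift T ℤ]
  [∀ n : ℤ, (shiftFunctor T n).Additive] [Pretriangulated T]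
  (F : S ⥤ T) [F.CommShift ℤ] [F.IsTriangulated]

/-- The map `F(ΣE) ≅ ΣF(E) ⟶ ΣX` obtained from `α : F(E) ⟶ X`. -/
def shiftCocone {E : ℕ ⥤ S} {X : T} (α : E ⋙ F ⟶ (Functor.const ℕ).obj X) :
    (E ⋙ shiftFunctor S (1 : ℤ)) ⋙ F ⟶ (Functor.const ℕ).obj (X⟦(1 : ℤ)⟧) where
  app n := (F.commShiftIso (1 : ℤ)).hom.app (E.obj n) ≫ (α.app n)⟦(1 : ℤ)⟧'
  naturality := by
    intro m n f
    have h : F.map (E.map f) ≫ α.app n = α.app m :=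
      (α.naturality f).trans (Category.comp_id _)
    have h2 := (F.commShiftIso (1 : ℤ)).hom.naturality (E.map f)
    simp only [Functor.comp_map] at h2
    refine Eq.trans ?_ (Category.comp_id _).symm
    simp only [Functor.comp_map]
    rw [← Category.assoc, h2, Category.assoc, ← Functor.map_comp, h]

/-- `F : S ⥤ T`, a triangulated functor, is a good extension with respect to the metric: it is
fully faithful, for every Cauchy sequence `E` in `S` the coproduct of the `F (E n)` exists in `T`,
and the natural map `colim Y(E) ⟶ 𝒴(hocolim F(E))` is an isomorphism. -/
structure IsGoodExtension (M : ℕ → ObjectProperty S) : Prop where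
  full : F.Full
  faithful : F.Faithful
  hasCoproduct : ∀ E : ℕ ⥤ S, IsCauchy M E → HasCoproduct (fun n => F.obj (E.obj n))
  isIso : ∀ E : ℕ ⥤ S, IsCauchy M E → ∀ (X : T) (α : E ⋙ F ⟶ (Functor.const ℕ).obj X),
    IsHocolim (E ⋙ F) α → IsIso (colimYonedaDesc F α)

/-- The full subcategory `𝔏'(S)` of `T`: the objects isomorphic to homotopy colimits of the images
under `F` of Cauchy sequences in `S`. -/
def hocolimSubcategory (M : ℕ → ObjectProperty S) : ObjectProperty T :=
  fun X => ∃ (E : ℕ ⥤ S) (α : E ⋙ F ⟶ (Functor.const ℕ).obj X), IsCauchy M E ∧ IsHocolim (E ⋙ F) α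

/-- Commutativity in `T` of the diagram
```
F(a) ⟶ F(b) ⟶ F(c) ⟶ ΣF(a)
 |      |      |       |
 α      β      γ       Σα
 v      v      v       v
 A  ⟶   B  ⟶   C  ⟶   ΣA
```
-/
structure IsMapToTriangle {a b c : ℕ ⥤ S}
    (f : a ⟶ b) (g : b ⟶ c) (h : c ⟶ a ⋙ shiftFunctor S (1 : ℤ))
    {A B C : T} (φ : A ⟶ B) (ψ : B ⟶ C) (χ : C ⟶ A⟦(1 : ℤ)⟧)
    (α : a ⋙ F ⟶ (Functor.const ℕ).obj A) (β : b ⋙ F ⟶ (Functor.const ℕ).obj B)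
    (γ : c ⋙ F ⟶ (Functor.const ℕ).obj C) : Prop where
  comm₁ : ∀ n, F.map (f.app n) ≫ β.app n = α.app n ≫ φ
  comm₂ : ∀ n, F.map (g.app n) ≫ γ.app n = β.app n ≫ ψ
  comm₃ : ∀ n, F.map (h.app n) ≫ (shiftCocone F α).app n = γ.app n ≫ χ

/-- The natural maps induced by `α`, `β`, `γ`, `Σα` form an isomorphism, in `Mod-S`, from the
sequence `colim Y(a) ⟶ colim Y(b) ⟶ colim Y(c) ⟶ colim Y(Σa)`
to the sequence `𝒴(A) ⟶ 𝒴(B) ⟶ 𝒴(C) ⟶ 𝒴(ΣA)`. -/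
structure IsIsoToYoneda {a b c : ℕ ⥤ S}
    (f : a ⟶ b) (g : b ⟶ c) (h : c ⟶ a ⋙ shiftFunctor S (1 : ℤ))
    {A B C : T} (φ : A ⟶ B) (ψ : B ⟶ C) (χ : C ⟶ A⟦(1 : ℤ)⟧)
    (α : a ⋙ F ⟶ (Functor.const ℕ).obj A) (β : b ⋙ F ⟶ (Functor.const ℕ).obj B)
    (γ : c ⋙ F ⟶ (Functor.const ℕ).obj C) : Prop where
  isIso₁ : IsIso (colimYonedaDesc F α)
  isIso₂ : IsIso (colimYonedaDesc F β)
  isIso₃ : IsIso (colimYonedaDesc F γ)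
  isIso₄ : IsIso (colimYonedaDesc F (shiftCocone F α))
  comm₁ : ColimYonedaEq F α β f φ
  comm₂ : ColimYonedaEq F β γ g ψ
  comm₃ : ColimYonedaEq F γ (shiftCocone F α) h χ

/-- The restriction of `α : F(E) ⟶ X` to a subsequence of `E`. -/
def subseqCocone {F : S ⥤ T} {E : ℕ ⥤ S} {X : T} (α : E ⋙ F ⟶ (Functor.const ℕ).obj X)
    {ρ : ℕ → ℕ} (hρ : StrictMono ρ) : subseq E hρ ⋙ F ⟶ (Functor.const ℕ).obj X where
  app n := α.app (ρ n)
  naturality := fun _ _ f => α.naturality (hρ.monotone.functor.map f)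

end GoodExtension

end MetricTriangulated

end

/-!
The proof replaces statements about homotopy colimits by statements about morphisms out of objects
of `S`. Call a family of maps `α n : F (x n) ⟶ X` an approximation of `X` if, for every `i`, the map
`Hom(e, x n) ⟶ Hom(F e, X)` is bijective for all `e ∈ ⊥(M i)` once `n` is large
(`IsApproximation`). This notion is flexible: it passes to subsequences and shifts, it needs no
maps between the `x n`, and by the five lemma it passes to cones (`IsApproximation.cone`).

* Homotopy colimits of Cauchy sequences are approximations (`IsGoodExtension.isApproximation`),
  because the cones of `x m ⟶ x m'` receive no maps from `⊥(M i)`.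
* Conversely a sequence that approximates an object is Cauchy (`IsApproximation.isCauchy`). The cone
  of `x m ⟶ x m'` is right orthogonal to `⊥(M n)`, and the truncation triangles of a very good
  metric show that such an object is a retract of an object of `M i`.
* An object `X` in the left orthogonal of `F(S)⊥` that is approximated by a sequence is its homotopy
  colimit (`IsGoodExtension.isHocolim_of_isApproximation`). Indeed the comparison map from a
  homotopy colimit becomes an isomorphism under `𝒴`, hence is one by a Whitehead-type argument
  (`isIso_of_bijective`). The condition on `X` is stable under cones and holds for all homotopy
  colimits.

Given `φ : A ⟶ B`, a lift `f : a ⟶ b` to Cauchy sequences exists after passing to a subsequence of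
`b`, since each `F (a n) ⟶ A ⟶ B` factors through some `F (b m)` (`exists_lift_subseq`). For a
triangle on `φ`, choose arbitrary cones `c n` of the maps `f.app n` and arbitrary fill-ins
`γ n : F (c n) ⟶ C`. These approximate `C`, so `Hom(c k, c n) ⟶ Hom(F (c k), C)` is bijective for
`n` large. Hence `γ k` factors uniquely through `γ n`, and along a subsequence these factorizations
are the wanted maps of triangles (`exists_triangles`). Every remaining assertion follows from
the facts above.
-/

namespace MetricTriangulated

/-! ### Elements of `colim Y(E)` and its comparison with `𝒴(X)` -/

section Sequences

variable {S : Type u} [Category.{v} S] {T : Type u'} [Category.{v} T]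

lemma map_comp_cocone_app (F : S ⥤ T) {E : ℕ ⥤ S} {X : T} (α : E ⋙ F ⟶ (Functor.const ℕ).obj X)
    {m n : ℕ} (f : m ⟶ n) : F.map (E.map f) ≫ α.app n = α.app m :=
  (α.naturality f).trans (Category.comp_id _)

end Sequences

section Yoneda

variable {S : Type u} [Category.{v} S] [Preadditive S]

lemma preservesFilteredColimits_forget :
    PreservesFilteredColimitsOfSize.{0, 0} (forget AddCommGrpCat.{v}) :=
  preservesFilteredColimitsOfSize_shrink.{0, v, 0, v} _

/-- Every element of `colim Y(E)` at the object `e` is represented by some `e ⟶ E n`. -/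
lemma exists_rep_colimit_yoneda (E : ℕ ⥤ S) (e : S)
    (z : (colimit (E ⋙ Y S)).obj (op e)) :
    ∃ (n : ℕ) (w : e ⟶ E.obj n),
      (ConcreteCategory.hom ((colimit.ι (E ⋙ Y S) n).app (op e))) w = z :=
  have := preservesFilteredColimits_forget.{v}
  Concrete.isColimit_exists_rep ((E ⋙ Y S) ⋙ (evaluation _ _).obj (op e))
    (isColimitOfPreserves ((evaluation _ _).obj (op e)) (colimit.isColimit (E ⋙ Y S))) z

/-- Two morphisms to terms of the sequence `E` define the same element of `colim Y(E)` if and only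
if they agree at some later term. -/
lemma colimit_yoneda_eq_iff (E : ℕ ⥤ S) (e : S) {m n : ℕ} (x : e ⟶ E.obj m) (y : e ⟶ E.obj n) :
    (ConcreteCategory.hom ((colimit.ι (E ⋙ Y S) m).app (op e))) x =
      (ConcreteCategory.hom ((colimit.ι (E ⋙ Y S) n).app (op e))) y ↔
    ∃ (k : ℕ) (hm : m ≤ k) (hn : n ≤ k), x ≫ E.map (homOfLE hm) = y ≫ E.map (homOfLE hn) := by
  have := preservesFilteredColimits_forget.{v}
  have := Concrete.isColimit_rep_eq_iff_exists ((E ⋙ Y S) ⋙ (evaluation _ _).obj (op e))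
    (isColimitOfPreserves ((evaluation _ _).obj (op e)) (colimit.isColimit (E ⋙ Y S))) x y
  refine this.trans ⟨?_, ?_⟩
  · rintro ⟨k, f, g, h⟩
    exact ⟨k, leOfHom f, leOfHom g, h⟩
  · rintro ⟨k, hm, hn, h⟩
    exact ⟨k, homOfLE hm, homOfLE hn, h⟩

variable {T : Type u'} [Category.{v} T] [Preadditive T] (F : S ⥤ T) [F.Additive]

lemma ι_colimYonedaDesc {E : ℕ ⥤ S} {X : T} (α : E ⋙ F ⟶ (Functor.const ℕ).obj X) (n : ℕ) :
    colimit.ι (E ⋙ Y S) n ≫ colimYonedaDesc F α =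
      yonedaComparison F (E.obj n) ≫ (restrictedYoneda F).map (α.app n) :=
  colimit.ι_desc _ _

lemma colimYonedaDesc_ι_apply {E : ℕ ⥤ S} {X : T} (α : E ⋙ F ⟶ (Functor.const ℕ).obj X)
    (e : S) (n : ℕ) (x : e ⟶ E.obj n) :
    (ConcreteCategory.hom ((colimYonedaDesc F α).app (op e)))
      ((ConcreteCategory.hom ((colimit.ι (E ⋙ Y S) n).app (op e))) x) =
    (show F.obj e ⟶ X from F.map x ≫ α.app n) :=
  ConcreteCategory.congr_hom (NatTrans.congr_app (ι_colimYonedaDesc F α n) (op e)) x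

/-- The map `colim Y(E) ⟶ 𝒴(X)` is an isomorphism when, for each `e`, the maps
`Hom(e, E n) ⟶ Hom(F e, X)` are bijective for all large `n`. -/
lemma isIso_colimYonedaDesc {E : ℕ ⥤ S} {X : T} (α : E ⋙ F ⟶ (Functor.const ℕ).obj X)
    (h : ∀ e : S, ∃ N, ∀ n ≥ N,
      Function.Bijective (fun x : e ⟶ E.obj n => F.map x ≫ α.app n)) :
    IsIso (colimYonedaDesc F α) := by
  refine (NatTrans.isIso_iff_isIso_app _).2 fun e => ?_
  obtain ⟨N, hN⟩ := h e.unop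
  rw [ConcreteCategory.isIso_iff_bijective]
  constructor
  · intro z₁ z₂ hz
    obtain ⟨m, x, rfl⟩ := exists_rep_colimit_yoneda E e.unop z₁
    obtain ⟨n, y, rfl⟩ := exists_rep_colimit_yoneda E e.unop z₂
    have hz' : F.map x ≫ α.app m = F.map y ≫ α.app n :=
      (colimYonedaDesc_ι_apply F α e.unop m x).symm.trans
        (hz.trans (colimYonedaDesc_ι_apply F α e.unop n y))
    refine (colimit_yoneda_eq_iff E e.unop x y).2 ⟨max N (max m n), by lia, by lia, ?_⟩
    apply (hN _ (le_max_left _ _)).1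
    simp only [Functor.map_comp, Category.assoc, map_comp_cocone_app, hz']
  · intro (w : F.obj e.unop ⟶ X)
    obtain ⟨x, hx⟩ := (hN N le_rfl).2 w
    exact ⟨_, (colimYonedaDesc_ι_apply F α e.unop N x).trans hx⟩

lemma exists_lift_of_isIso_colimYonedaDesc {E : ℕ ⥤ S} {X : T}
    (α : E ⋙ F ⟶ (Functor.const ℕ).obj X) [IsIso (colimYonedaDesc F α)] {e : S}
    (w : F.obj e ⟶ X) : ∃ (n : ℕ) (x : e ⟶ E.obj n), F.map x ≫ α.app n = w := by
  obtain ⟨z, hz⟩ := ((ConcreteCategory.isIso_iff_bijective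
    ((colimYonedaDesc F α).app (op e))).1 inferInstance).2 w
  obtain ⟨n, x, rfl⟩ := exists_rep_colimit_yoneda E e z
  exact ⟨n, x, (colimYonedaDesc_ι_apply F α e n x).symm.trans hz⟩

lemma exists_map_eq_of_isIso_colimYonedaDesc {E : ℕ ⥤ S} {X : T}
    (α : E ⋙ F ⟶ (Functor.const ℕ).obj X) [IsIso (colimYonedaDesc F α)] {e : S} {m n : ℕ}
    (x : e ⟶ E.obj m) (y : e ⟶ E.obj n) (h : F.map x ≫ α.app m = F.map y ≫ α.app n) :
    ∃ (k : ℕ) (hm : m ≤ k) (hn : n ≤ k), x ≫ E.map (homOfLE hm) = y ≫ E.map (homOfLE hn) := by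
  refine (colimit_yoneda_eq_iff E e x y).1 ?_
  apply ((ConcreteCategory.isIso_iff_bijective
    ((colimYonedaDesc F α).app (op e))).1 inferInstance).1
  exact (colimYonedaDesc_ι_apply F α e m x).trans
    (h.trans (colimYonedaDesc_ι_apply F α e n y).symm)

/-- By the Yoneda lemma, the identity `colim Y(f) = 𝒴(φ)` means that `f` and `φ` form commutative
squares with the structure maps `F (E n) ⟶ X` and `F (E' n) ⟶ X'`. -/
lemma colimYonedaEq_iff {E E' : ℕ ⥤ S} {X X' : T} (α : E ⋙ F ⟶ (Functor.const ℕ).obj X)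
    (α' : E' ⋙ F ⟶ (Functor.const ℕ).obj X') (f : E ⟶ E') (φ : X ⟶ X') :
    ColimYonedaEq F α α' f φ ↔ ∀ n, F.map (f.app n) ≫ α'.app n = α.app n ≫ φ := by
  have h₁ (n : ℕ) : colimit.ι (E ⋙ Y S) n ≫ colimYonedaMap f ≫ colimYonedaDesc F α' =
      (Y S).map (f.app n) ≫ yonedaComparison F (E'.obj n) ≫
        (restrictedYoneda F).map (α'.app n) := by
    rw [colimYonedaMap, ι_colimMap_assoc, ι_colimYonedaDesc]
    rfl
  have h₂ (n : ℕ) : colimit.ι (E ⋙ Y S) n ≫ colimYonedaDesc F α ≫ (restrictedYoneda F).map φ =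
      yonedaComparison F (E.obj n) ≫ (restrictedYoneda F).map (α.app n) ≫
        (restrictedYoneda F).map φ := by
    rw [reassoc_of% ι_colimYonedaDesc F α n]
  constructor
  · intro h n
    have h₃ := congr_arg (fun g => colimit.ι (E ⋙ Y S) n ≫ g) h
    simp only [h₁, h₂] at h₃
    have h₄ : F.map (𝟙 (E.obj n) ≫ f.app n) ≫ α'.app n =
        (F.map (𝟙 (E.obj n)) ≫ α.app n) ≫ φ :=
      ConcreteCategory.congr_hom (NatTrans.congr_app h₃ (op (E.obj n))) (𝟙 (E.obj n))
    simpa using h₄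
  · intro h
    refine colimit.hom_ext fun n => ?_
    rw [h₁, h₂, ← Functor.map_comp, ← h n, Functor.map_comp, ← Category.assoc,
      yonedaComparison_naturality, Category.assoc]

end Yoneda

/-! ### Approximations of objects of `T` by objects of `S` -/

section Metric

variable {S : Type u} [Category.{v} S] [Preadditive S] [HasShift S ℤ]
  [∀ n : ℤ, (shiftFunctor S n).Additive] {M : ℕ → ObjectProperty S}

lemma leftOrthogonal_shift_neg {i : ℕ} (n : ℤ) (hn : ∀ X, M (i + 1) X → M i (X⟦n⟧)) {e : S}
    (he : (M i).leftOrthogonal e) : (M (i + 1)).leftOrthogonal (e⟦-n⟧) := by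
  intro y f hy
  apply (shiftFunctor S n).map_injective
  rw [Functor.map_zero]
  exact (M i).leftOrthogonal.prop_of_iso (shiftNegShift e n).symm he _ (hn y hy)

variable [HasZeroObject S] [Pretriangulated S]

/-- The transition maps of a Cauchy sequence eventually induce bijections on morphisms out of the
objects of `⊥(M i)`. -/
lemma IsCauchy.exists_bijective_comp_map (hM : IsGoodMetric M) {E : ℕ ⥤ S} (hE : IsCauchy M E)
    (i : ℕ) : ∃ N, ∀ (m m' : ℕ) (h : m ≤ m'), N ≤ m → ∀ e, (M i).leftOrthogonal e →
      Function.Bijective (fun x : e ⟶ E.obj m => x ≫ E.map (homOfLE h)) := by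
  obtain ⟨N, hN⟩ := hE (i + 1)
  refine ⟨N, fun m m' h hm e he => ?_⟩
  obtain ⟨D, q, r, hT⟩ := distinguished_cocone_triangle (E.map (homOfLE h))
  have hD := hN m m' h hm D q r hT
  constructor
  · intro x y hxy
    obtain ⟨z, hz⟩ := Triangle.coyoneda_exact₂ _ (inv_rot_of_distTriang _ hT) (x - y)
      ((Preadditive.sub_comp _ _ _).trans (sub_eq_zero.2 hxy))
    have hz0 : z = 0 := he z (hM.shift_neg i D hD)
    rw [hz0, zero_comp] at hz
    exact sub_eq_zero.1 hz
  · intro y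
    obtain ⟨x, hx⟩ := Triangle.coyoneda_exact₂ _ hT y (he _ (hM.le i D hD))
    exact ⟨x, hx.symm⟩

/-- For a very good metric with `M i` closed under retracts, `(⊥(M n))⊥ ⊆ M m` for some `n`: the
first map of a triangle `E ⟶ D ⟶ D' ⟶ ΣE` with `E ∈ ⊥(M n)` and `D' ∈ M m` vanishes, so `D` is a
retract of `D'`. -/
lemma IsVeryGoodMetric.exists_mem_of_leftOrthogonal (hM : IsVeryGoodMetric M)
    (hM_summands : ∀ i, (M i).IsStableUnderRetracts) (m : ℕ) :
    ∃ n, ∀ D : S, (∀ (e : S) (f : e ⟶ D), (M n).leftOrthogonal e → f = 0) → M m D := by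
  obtain ⟨n, -, hn⟩ := hM.exists_triangle m
  refine ⟨n, fun D hD => ?_⟩
  obtain ⟨e, D', p, q, r, hT, he, hD'⟩ := hn D
  have : Mono q := (Triangle.mor₁_eq_zero_iff_mono₂ _ hT).1 (hD e p he)
  have : IsSplitMono q := isSplitMono_of_mono q
  exact (hM_summands m).of_retract ⟨q, retraction q, IsSplitMono.id q⟩ hD'

end Metric

section Approximation

variable {S : Type u} [Category.{v} S] [Preadditive S] {T : Type u'} [Category.{v} T]
  {F : S ⥤ T} {M : ℕ → ObjectProperty S}

variable (F M) in
/-- A family of maps `α n : F (x n) ⟶ X` approximates `X` if, for every `i`, the maps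
`Hom(e, x n) ⟶ Hom(F e, X)` are bijective for all `e ∈ ⊥(M i)` as soon as `n` is large (uniformly
in `e`). The objects `x n` need not be connected by any maps. -/
def IsApproximation (x : ℕ → S) {X : T} (α : ∀ n, F.obj (x n) ⟶ X) : Prop :=
  ∀ i, ∃ N, ∀ n ≥ N, ∀ e, (M i).leftOrthogonal e →
    Function.Bijective (fun u : e ⟶ x n => F.map u ≫ α n)

namespace IsApproximation

variable {x : ℕ → S} {X : T} {α : ∀ n, F.obj (x n) ⟶ X}

lemma exists_bijective (h : IsApproximation F M x α)
    (hM : ∀ e : S, ∃ i, (M i).leftOrthogonal e) (e : S) :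
    ∃ N, ∀ n ≥ N, Function.Bijective (fun u : e ⟶ x n => F.map u ≫ α n) := by
  obtain ⟨i, hi⟩ := hM e
  obtain ⟨N, hN⟩ := h i
  exact ⟨N, fun n hn => hN n hn e hi⟩

lemma comp_strictMono (h : IsApproximation F M x α) {ρ : ℕ → ℕ} (hρ : StrictMono ρ) :
    IsApproximation F M (fun n => x (ρ n)) (fun n => α (ρ n)) := by
  intro i
  obtain ⟨N, hN⟩ := h i
  exact ⟨N, fun n hn => hN (ρ n) (hn.trans hρ.le_apply)⟩

end IsApproximation

lemma IsApproximation.isIso_colimYonedaDesc [Preadditive T] [F.Additive] {E : ℕ ⥤ S} {X : T}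
    {α : E ⋙ F ⟶ (Functor.const ℕ).obj X} (h : IsApproximation F M E.obj α.app)
    (hM : ∀ e : S, ∃ i, (M i).leftOrthogonal e) : IsIso (colimYonedaDesc F α) :=
  MetricTriangulated.isIso_colimYonedaDesc F α (h.exists_bijective hM)

variable [HasShift S ℤ] [∀ n : ℤ, (shiftFunctor S n).Additive]

lemma IsApproximation.shift [HasShift T ℤ] [F.CommShift ℤ] {x : ℕ → S} {X : T}
    {α : ∀ n, F.obj (x n) ⟶ X} (h : IsApproximation F M x α) (n : ℤ)
    (hn : ∀ i X, M (i + 1) X → M i (X⟦n⟧)) :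
    IsApproximation F M (fun k => (x k)⟦n⟧)
      (fun k => (F.commShiftIso n).hom.app (x k) ≫ (α k)⟦n⟧') := by
  intro i
  obtain ⟨N, hN⟩ := h (i + 1)
  refine ⟨N, fun k hk e he => ?_⟩
  have h₁ := hN k hk _ (leftOrthogonal_shift_neg n (hn i) he)
  let j := shiftNegShift e n
  have h₂ : Function.Bijective (fun u : e⟦-n⟧ ⟶ x k => j.inv ≫ u⟦n⟧') :=
    j.homFromEquiv.bijective.comp
      (Functor.FullyFaithful.ofFullyFaithful (shiftFunctor S n)).homEquiv.bijective
  have h₃ : Function.Bijective (fun w : F.obj (e⟦-n⟧) ⟶ X =>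
      F.map j.inv ≫ (F.commShiftIso n).hom.app (e⟦-n⟧) ≫ w⟦n⟧') := by
    constructor
    · intro w w' hw
      exact (shiftFunctor T n).map_injective ((cancel_epi _).1 ((cancel_epi _).1 hw))
    · intro w
      obtain ⟨w', hw'⟩ := (shiftFunctor T n).map_surjective
        ((F.commShiftIso n).inv.app (e⟦-n⟧) ≫ F.map j.hom ≫ w)
      refine ⟨w', ?_⟩
      simp only [hw', Iso.hom_inv_id_app_assoc, ← F.map_comp_assoc, Iso.inv_hom_id, F.map_id,
        Category.id_comp]
  rw [← Function.Bijective.of_comp_iff _ h₂]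
  convert h₃.comp h₁ using 1
  funext u
  simp

variable [HasZeroObject S] [Pretriangulated S] [Preadditive T]

lemma IsCauchy.isApproximation [F.Additive] (hM : IsGoodMetric M) {E : ℕ ⥤ S}
    (hE : IsCauchy M E) {X : T} (α : E ⋙ F ⟶ (Functor.const ℕ).obj X)
    [IsIso (colimYonedaDesc F α)] :
    IsApproximation F M E.obj α.app := by
  intro i
  obtain ⟨N, hN⟩ := hE.exists_bijective_comp_map hM i
  refine ⟨N, fun n hn e he => ⟨fun x y hxy => ?_, fun w => ?_⟩⟩
  · obtain ⟨k, hk, hk', hxy'⟩ := exists_map_eq_of_isIso_colimYonedaDesc F α x y hxy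
    exact (hN n k hk hn e he).1 hxy'
  · obtain ⟨m, y, rfl⟩ := exists_lift_of_isIso_colimYonedaDesc F α w
    obtain ⟨x, hx⟩ := (hN n (max n m) (le_max_left _ _) hn e he).2
      (y ≫ E.map (homOfLE (le_max_right n m)))
    refine ⟨x, ?_⟩
    have := congr_arg (fun z => F.map z ≫ α.app (max n m)) hx
    simpa only [F.map_comp, Category.assoc, map_comp_cocone_app] using this

variable [HasZeroObject T] [HasShift T ℤ] [∀ n : ℤ, (shiftFunctor T n).Additive]
  [Pretriangulated T]

/-- The five lemma: morphisms of triangles from `F (a n) ⟶ F (b n) ⟶ F (c n) ⟶ ΣF (a n)` to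
`A ⟶ B ⟶ C ⟶ ΣA` approximate `C` if they approximate `A` and `B`. -/
lemma IsApproximation.cone [F.CommShift ℤ] [F.IsTriangulated] (hM : IsGoodMetric M) {a b c : ℕ → S}
    {f : ∀ n, a n ⟶ b n} {g : ∀ n, b n ⟶ c n} {h : ∀ n, c n ⟶ (a n)⟦(1 : ℤ)⟧}
    (hT : ∀ n, Triangle.mk (f n) (g n) (h n) ∈ distTriang S)
    {A B C : T} {φ : A ⟶ B} {ψ : B ⟶ C} {χ : C ⟶ A⟦(1 : ℤ)⟧}
    (hφ : Triangle.mk φ ψ χ ∈ distTriang T)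
    {α : ∀ n, F.obj (a n) ⟶ A} {β : ∀ n, F.obj (b n) ⟶ B} {γ : ∀ n, F.obj (c n) ⟶ C}
    (hf : ∀ n, F.map (f n) ≫ β n = α n ≫ φ) (hg : ∀ n, F.map (g n) ≫ γ n = β n ≫ ψ)
    (hh : ∀ n, F.map (h n) ≫ (F.commShiftIso (1 : ℤ)).hom.app (a n) ≫ (α n)⟦(1 : ℤ)⟧' = γ n ≫ χ)
    (hα : IsApproximation F M a α) (hβ : IsApproximation F M b β) :
    IsApproximation F M c γ := by
  intro i
  obtain ⟨N₁, h₁⟩ := hα i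
  obtain ⟨N₂, h₂⟩ := hβ i
  obtain ⟨N₃, h₃⟩ := hα.shift 1 hM.shift i
  obtain ⟨N₄, h₄⟩ := hβ.shift 1 hM.shift i
  refine ⟨max (max N₁ N₂) (max N₃ N₄), fun n hn e he => ?_⟩
  replace h₁ := h₁ n (by lia) e he
  replace h₂ := h₂ n (by lia) e he
  replace h₃ := h₃ n (by lia) e he
  replace h₄ := h₄ n (by lia) e he
  have hχφ : χ ≫ φ⟦(1 : ℤ)⟧' = 0 := comp_distTriang_mor_zero₃₁ _ hφ
  have hfg : f n ≫ g n = 0 := comp_distTriang_mor_zero₁₂ _ (hT n)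
  constructor
  · intro u u' huu'
    rw [← sub_eq_zero]
    have hu : F.map (u - u') ≫ γ n = 0 := by
      rw [F.map_sub, Preadditive.sub_comp]
      exact sub_eq_zero.2 huu'
    generalize u - u' = u at hu
    have hu₁ : u ≫ h n = 0 := h₃.1 (by simp [hh, reassoc_of% hu])
    obtain ⟨y, hy⟩ : ∃ y : e ⟶ b n, u = y ≫ g n := Triangle.coyoneda_exact₃ _ (hT n) u hu₁
    obtain ⟨w, hw⟩ : ∃ w : F.obj e ⟶ A, F.map y ≫ β n = w ≫ φ :=
      Triangle.coyoneda_exact₂ _ hφ (F.map y ≫ β n) (by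
        change (F.map y ≫ β n) ≫ ψ = 0
        rw [Category.assoc, ← hg, ← F.map_comp_assoc, ← hy, hu])
    obtain ⟨z, hz⟩ := h₁.2 w
    have hzy : z ≫ f n = y := h₂.1 (by
      simp only [F.map_comp, Category.assoc, hf, hw, ← hz])
    rw [hy, ← hzy, Category.assoc, hfg, comp_zero]
  · intro w
    obtain ⟨p, hp⟩ := h₃.2 (w ≫ χ)
    have hp₁ : p ≫ (f n)⟦(1 : ℤ)⟧' = 0 := h₄.1 (by
      have h₅ : F.map ((f n)⟦(1 : ℤ)⟧') ≫ (F.commShiftIso (1 : ℤ)).hom.app (b n) =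
        (F.commShiftIso (1 : ℤ)).hom.app (a n) ≫ (F.map (f n))⟦(1 : ℤ)⟧' :=
          (F.commShiftIso (1 : ℤ)).hom.naturality (f n)
      have h₆ := congr_arg (fun q => q ≫ φ⟦(1 : ℤ)⟧') hp
      simp only [Category.assoc, ← Functor.map_comp, hχφ, comp_zero] at h₆
      simp only [F.map_comp, F.map_zero, zero_comp, Category.assoc]
      rw [reassoc_of% h₅, ← Functor.map_comp, hf, h₆])
    obtain ⟨q, hq⟩ : ∃ q : e ⟶ c n, p = q ≫ h n := Triangle.coyoneda_exact₁ _ (hT n) p hp₁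
    obtain ⟨y, hy⟩ : ∃ y : F.obj e ⟶ B, w - F.map q ≫ γ n = y ≫ ψ :=
      Triangle.coyoneda_exact₃ _ hφ (w - F.map q ≫ γ n) (by
        change (w - F.map q ≫ γ n) ≫ χ = 0
        rw [Preadditive.sub_comp, sub_eq_zero, ← hp, Category.assoc, ← hh, hq]
        simp only [F.map_comp, Category.assoc])
    obtain ⟨z, hz⟩ := h₂.2 y
    refine ⟨q + z ≫ g n, ?_⟩
    dsimp only at hz ⊢
    rw [F.map_add, F.map_comp, Preadditive.add_comp, Category.assoc, hg, reassoc_of% hz, ← hy]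
    abel

/-- A sequence which approximates some object of `T` is Cauchy. -/
lemma IsApproximation.isCauchy [F.CommShift ℤ] [F.IsTriangulated] (hM : IsVeryGoodMetric M)
    (hM_summands : ∀ i, (M i).IsStableUnderRetracts) {E : ℕ ⥤ S} {X : T}
    {α : E ⋙ F ⟶ (Functor.const ℕ).obj X} (h : IsApproximation F M E.obj α.app) :
    IsCauchy M E := by
  intro i
  obtain ⟨n, hn⟩ := hM.exists_mem_of_leftOrthogonal hM_summands i
  obtain ⟨N₁, h₁⟩ := h n
  obtain ⟨N₂, h₂⟩ := h.shift 1 hM.shift n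
  refine ⟨max N₁ N₂, fun m m' hm hN D q r hT => hn D fun e p he => ?_⟩
  have hw := map_comp_cocone_app F α (homOfLE hm)
  have hp : p ≫ r = 0 := (h₂ m (by lia) e he).1 (by
    have h₃ : r ≫ (E.map (homOfLE hm))⟦(1 : ℤ)⟧' = 0 := comp_distTriang_mor_zero₃₁ _ hT
    have h₄ : F.map ((E.map (homOfLE hm))⟦(1 : ℤ)⟧') ≫
        (F.commShiftIso (1 : ℤ)).hom.app (E.obj m') =
      (F.commShiftIso (1 : ℤ)).hom.app (E.obj m) ≫ (F.map (E.map (homOfLE hm)))⟦(1 : ℤ)⟧' :=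
        (F.commShiftIso (1 : ℤ)).hom.naturality (E.map (homOfLE hm))
    have h₅ : (α.app m)⟦(1 : ℤ)⟧' =
        (F.map (E.map (homOfLE hm)))⟦(1 : ℤ)⟧' ≫ (α.app m')⟦(1 : ℤ)⟧' := by
      rw [← Functor.map_comp, hw]
    dsimp only
    rw [h₅, ← reassoc_of% h₄, ← F.map_comp_assoc, Category.assoc, h₃, comp_zero]
    simp)
  obtain ⟨p', hp'⟩ : ∃ p' : e ⟶ E.obj m', p = p' ≫ q := Triangle.coyoneda_exact₃ _ hT p hp
  obtain ⟨y, hy⟩ := (h₁ m (by lia) e he).2 (F.map p' ≫ α.app m')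
  have hy' : y ≫ E.map (homOfLE hm) = p' := (h₁ m' (by lia) e he).1 (by
    dsimp only at hy ⊢
    rw [F.map_comp, Category.assoc, hw, hy])
  have hEq : E.map (homOfLE hm) ≫ q = 0 := comp_distTriang_mor_zero₁₂ _ hT
  rw [hp', ← hy', Category.assoc, hEq, comp_zero]

end Approximation

/-! ### Homotopy colimits and the Whitehead theorem -/

section Hocolim

variable {S : Type u} [Category.{v} S] [HasShift S ℤ]
  {T : Type u'} [Category.{v} T] [Preadditive T] [HasZeroObject T] [HasShift T ℤ]
  [∀ n : ℤ, (shiftFunctor T n).Additive] [Pretriangulated T]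

/-- The objects of `T` built from `S`: the left orthogonal of `{Z | Hom(F e, Z) = 0 for all e}`.
It contains all homotopy colimits of sequences in `S`, and morphisms between its objects are
isomorphisms as soon as they become so after applying `𝒴`. -/
abbrev generatedBy (F : S ⥤ T) : ObjectProperty T :=
  F.essImage.rightOrthogonal.leftOrthogonal

variable (F : S ⥤ T) [F.CommShift ℤ]

instance : F.essImage.IsStableUnderShift ℤ where
  isStableUnderShiftBy n :=
    { le_shift := by
        rintro X ⟨e, ⟨i⟩⟩
        exact ⟨e⟦n⟧, ⟨(F.commShiftIso n).app e ≪≫ (shiftFunctor T n).mapIso i⟩⟩ }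

variable {F}

lemma generatedBy_of_isHocolim {E : ℕ ⥤ S} {X : T} {α : E ⋙ F ⟶ (Functor.const ℕ).obj X}
    (h : IsHocolim (E ⋙ F) α) : generatedBy F X := by
  obtain ⟨c, hc, δ, hT⟩ := h
  have hpt : generatedBy F c.pt := fun Z f hZ =>
    Cofan.IsColimit.hom_ext hc _ _ fun n => by
      rw [comp_zero]
      exact hZ _ (F.obj_mem_essImage (E.obj n))
  exact (generatedBy F).ext_of_isTriangulatedClosed₃ _ hT hpt hpt

/-- The Whitehead theorem for restricted Yoneda: if `u` induces bijections on morphisms out of all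
`F e`, then its cone receives no nonzero map from any `F e`; so the identity of the cone, which
factors through `X'⟦1⟧` because `X ⟶ cone` vanishes, is zero. -/
lemma isIso_of_bijective {X' X : T} (u : X' ⟶ X) (hX' : generatedBy F X')
    (hX : generatedBy F X)
    (hu : ∀ e : S, Function.Bijective (fun w : F.obj e ⟶ X' => w ≫ u)) : IsIso u := by
  obtain ⟨Z, q, r, hT⟩ := distinguished_cocone_triangle u
  refine (Triangle.isZero₃_iff_isIso₁ _ hT).1 ?_
  have hZ : F.essImage.rightOrthogonal Z := by
    rintro _ w ⟨e, ⟨i⟩⟩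
    let j : (F.obj (e⟦(-1 : ℤ)⟧))⟦(1 : ℤ)⟧ ≅ F.obj e :=
      ((F.commShiftIso (1 : ℤ)).app _).symm ≪≫ F.mapIso (shiftNegShift e (1 : ℤ))
    have hru : r ≫ u⟦(1 : ℤ)⟧' = 0 := comp_distTriang_mor_zero₃₁ _ hT
    have hwr : w ≫ r = 0 := by
      obtain ⟨y, hy⟩ := (shiftFunctor T (1 : ℤ)).map_surjective (j.hom ≫ i.hom ≫ w ≫ r)
      have hyu : y ≫ u = 0 := (shiftFunctor T (1 : ℤ)).map_injective (by
        rw [Functor.map_comp, hy]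
        simp [hru])
      have hy0 : y = 0 := (hu _).1 (by simpa using hyu)
      rw [hy0, Functor.map_zero] at hy
      rw [← cancel_epi i.hom, ← cancel_epi j.hom, ← hy, comp_zero, comp_zero]
    obtain ⟨y, hy⟩ : ∃ y : _ ⟶ X, w = y ≫ q := Triangle.coyoneda_exact₃ _ hT w hwr
    obtain ⟨z, hz⟩ := (hu e).2 (i.hom ≫ y)
    have huq : u ≫ q = 0 := comp_distTriang_mor_zero₁₂ _ hT
    rw [← cancel_epi i.hom, hy, ← Category.assoc, ← hz, Category.assoc, huq, comp_zero, comp_zero]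
  have hq : q = 0 := hX q hZ
  obtain ⟨y, hy⟩ : ∃ y : X'⟦(1 : ℤ)⟧ ⟶ Z, 𝟙 Z = r ≫ y :=
    Triangle.yoneda_exact₃ _ hT (𝟙 Z) ((Category.comp_id q).trans hq)
  have hy0 : y = 0 := (generatedBy F).le_shift (1 : ℤ) X' hX' y hZ
  rw [hy0, comp_zero] at hy
  exact (IsZero.iff_id_eq_zero Z).2 hy

/-- A sequence whose terms have a coproduct has a homotopy colimit `X'`, any cocone `α` on it with
vertex `X` factors through some `u : X' ⟶ X`, and `α` is a homotopy colimit as soon as `u` is an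
isomorphism. -/
lemma exists_isHocolim (E : ℕ ⥤ T) [HasCoproduct E.obj] {X : T}
    (α : E ⟶ (Functor.const ℕ).obj X) :
    ∃ (X' : T) (α' : E ⟶ (Functor.const ℕ).obj X') (u : X' ⟶ X),
      IsHocolim E α' ∧ (∀ n, α'.app n ≫ u = α.app n) ∧ (IsIso u → IsHocolim E α) := by
  let c : Cofan E.obj := Cofan.mk _ (Sigma.ι E.obj)
  have hc : IsColimit c := coproductIsCoproduct E.obj
  let s : c.pt ⟶ c.pt :=
    𝟙 c.pt - Cofan.IsColimit.desc hc (fun n => E.map (homOfLE n.le_succ) ≫ c.inj (n + 1))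
  have hs (n : ℕ) : c.inj n ≫ s = c.inj n - E.map (homOfLE n.le_succ) ≫ c.inj (n + 1) := by
    simp [s, Preadditive.comp_sub]
  obtain ⟨X', p, δ, hT⟩ := distinguished_cocone_triangle s
  have hsp : s ≫ p = 0 := comp_distTriang_mor_zero₁₂ _ hT
  let α' : E ⟶ (Functor.const ℕ).obj X' := NatTrans.ofSequence (fun n => c.inj n ≫ p) (fun n => by
    have := congr_arg (fun t => c.inj n ≫ t) hsp
    simp only [← Category.assoc, hs, comp_zero, Preadditive.sub_comp, sub_eq_zero] at this
    simp [this])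
  have hα' : Cofan.IsColimit.desc hc (fun n => α'.app n) = p :=
    Cofan.IsColimit.hom_ext hc _ _ fun n => by simp [α']
  let d : c.pt ⟶ X := Cofan.IsColimit.desc hc (fun n => α.app n)
  have hsd : s ≫ d = 0 := Cofan.IsColimit.hom_ext hc _ _ fun n => by
    have h := (α.naturality (homOfLE n.le_succ)).trans (Category.comp_id _)
    rw [← Category.assoc, hs, Preadditive.sub_comp, comp_zero, sub_eq_zero]
    simp [d, h]
  obtain ⟨u, hu⟩ : ∃ u : X' ⟶ X, d = p ≫ u := Triangle.yoneda_exact₂ _ hT d hsd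
  refine ⟨X', α', u, ⟨c, hc, δ, by rw [hα']; exact hT⟩, fun n => ?_, fun _ => ?_⟩
  · have := congr_arg (fun t => c.inj n ≫ t) hu
    simpa [d, α'] using this.symm
  · refine ⟨c, hc, inv u ≫ δ, isomorphic_distinguished _ hT _ ?_⟩
    refine Triangle.isoMk _ _ (Iso.refl _) (Iso.refl _) (asIso u).symm ?_ ?_ ?_
    · change s ≫ 𝟙 _ = 𝟙 _ ≫ s
      simp
    · change d ≫ inv u = 𝟙 _ ≫ p
      simp [hu]
    · change (inv u ≫ δ) ≫ (shiftFunctor T (1 : ℤ)).map (𝟙 c.pt) = inv u ≫ δ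
      simp

end Hocolim

/-! ### Lifting morphisms and triangles to sequences -/

section Lift

variable {S : Type u} [Category.{v} S] [Preadditive S] {T : Type u'} [Category.{v} T]
  [Preadditive T] (F : S ⥤ T) [F.Additive]

lemma exists_strictMono_ge (P : ℕ → ℕ) : ∃ σ : ℕ → ℕ, StrictMono σ ∧ ∀ k, P k ≤ σ k :=
  ⟨fun k => k + ∑ i ∈ Finset.range (k + 1), P i,
    strictMono_nat_of_lt_succ fun k => by rw [Finset.sum_range_succ _ (k + 1)]; lia,
    fun k => by dsimp only; rw [Finset.sum_range_succ]; lia⟩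

/-- A morphism between objects computed by sequences `a` and `b` lifts to a map of sequences from
`a` to a subsequence of `b`. -/
lemma exists_lift_subseq {A B : T} (φ : A ⟶ B) {a b : ℕ ⥤ S}
    (α : a ⋙ F ⟶ (Functor.const ℕ).obj A) (β : b ⋙ F ⟶ (Functor.const ℕ).obj B)
    [IsIso (colimYonedaDesc F β)] :
    ∃ (σ : ℕ → ℕ) (hσ : StrictMono σ) (f : a ⟶ subseq b hσ),
      ∀ n, F.map (f.app n) ≫ β.app (σ n) = α.app n ≫ φ := by
  choose p x hx using fun k => exists_lift_of_isIso_colimYonedaDesc F β (α.app k ≫ φ)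
  choose K hK hK' hxK using fun k => exists_map_eq_of_isIso_colimYonedaDesc F β
    (x k) (a.map (homOfLE k.le_succ) ≫ x (k + 1)) (by
      rw [F.map_comp, Category.assoc, hx, hx, ← Category.assoc, map_comp_cocone_app])
  -- the bound `K (k - 1)` at the index `k` makes the square from `k - 1` to `k` commute
  obtain ⟨σ, hσ, hPσ⟩ := exists_strictMono_ge (fun k => max (p k) (K (k - 1)))
  have hpσ (k : ℕ) : p k ≤ σ k := (le_max_left _ _).trans (hPσ k)
  have hKσ (k : ℕ) : K k ≤ σ (k + 1) := (le_max_right _ _).trans (hPσ (k + 1))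
  refine ⟨σ, hσ, NatTrans.ofSequence (fun k => x k ≫ b.map (homOfLE (hpσ k))) (fun k => ?_),
    fun k => ?_⟩
  · have h := congr_arg (fun z => z ≫ b.map (homOfLE (hKσ k))) (hxK k)
    simp only [Category.assoc, ← b.map_comp] at h
    change a.map _ ≫ x (k + 1) ≫ b.map _ = (x k ≫ b.map _) ≫ b.map _
    rw [Category.assoc, ← b.map_comp]
    exact h.symm
  · change F.map (x k ≫ b.map (homOfLE (hpσ k))) ≫ β.app (σ k) = _
    rw [F.map_comp, Category.assoc, map_comp_cocone_app, hx]

end Lift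

section Extension

variable {S : Type u} [Category.{v} S] [Preadditive S] [HasZeroObject S] [HasShift S ℤ]
  [∀ n : ℤ, (shiftFunctor S n).Additive] [Pretriangulated S]
  {T : Type u'} [Category.{v} T] [Preadditive T] [HasZeroObject T] [HasShift T ℤ]
  [∀ n : ℤ, (shiftFunctor T n).Additive] [Pretriangulated T]
  {F : S ⥤ T} [F.CommShift ℤ] [F.IsTriangulated] {M : ℕ → ObjectProperty S}

/-- Recognition of homotopy colimits by their restricted Yoneda functor. -/
lemma IsGoodExtension.isHocolim (hF : IsGoodExtension F M) {E : ℕ ⥤ S} (hE : IsCauchy M E)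
    {X : T} (hX : generatedBy F X) (α : E ⋙ F ⟶ (Functor.const ℕ).obj X)
    [IsIso (colimYonedaDesc F α)] : IsHocolim (E ⋙ F) α := by
  have : HasCoproduct (E ⋙ F).obj := hF.hasCoproduct E hE
  obtain ⟨X', α', u, hα', hu, hiso⟩ := exists_isHocolim (E ⋙ F) α
  have := hF.isIso E hE X' α' hα'
  refine hiso (isIso_of_bijective (F := F) u (generatedBy_of_isHocolim hα') hX fun e =>
    ⟨fun w w' hw => ?_, fun w => ?_⟩)
  · obtain ⟨m, x, rfl⟩ := exists_lift_of_isIso_colimYonedaDesc F α' w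
    obtain ⟨n, y, rfl⟩ := exists_lift_of_isIso_colimYonedaDesc F α' w'
    simp only [Category.assoc, hu] at hw
    obtain ⟨k, hm, hn, hk⟩ := exists_map_eq_of_isIso_colimYonedaDesc F α x y hw
    have := congr_arg (fun z => F.map z ≫ α'.app k) hk
    simpa only [F.map_comp, Category.assoc, map_comp_cocone_app] using this
  · obtain ⟨n, x, rfl⟩ := exists_lift_of_isIso_colimYonedaDesc F α w
    exact ⟨F.map x ≫ α'.app n, by simp [hu]⟩

lemma IsGoodExtension.isApproximation (hF : IsGoodExtension F M) (hM : IsGoodMetric M)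
    {E : ℕ ⥤ S} (hE : IsCauchy M E) {X : T} {α : E ⋙ F ⟶ (Functor.const ℕ).obj X}
    (hα : IsHocolim (E ⋙ F) α) : IsApproximation F M E.obj α.app :=
  have := hF.isIso E hE X α hα
  hE.isApproximation hM α

lemma IsGoodExtension.isHocolim_of_isApproximation (hF : IsGoodExtension F M)
    (hM : IsVeryGoodMetric M) (hM_summands : ∀ i, (M i).IsStableUnderRetracts)
    {E : ℕ ⥤ S} {X : T} (hX : generatedBy F X) {α : E ⋙ F ⟶ (Functor.const ℕ).obj X}
    (hα : IsApproximation F M E.obj α.app) : IsHocolim (E ⋙ F) α :=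
  have := hα.isIso_colimYonedaDesc hM.exists_leftOrthogonal
  hF.isHocolim (hα.isCauchy hM hM_summands) hX α

/-- The cones of the maps `f.app n`, along a suitable subsequence, form a sequence of triangles that
approximates the given triangle on `φ`. The cones `c₀ n` and the maps `γ₀ n : F (c₀ n) ⟶ C` are
arbitrary. Since `Hom(c₀ k, c₀ n) ⟶ Hom(F (c₀ k), C)` is bijective for `n` large, `γ₀ k` factors
uniquely through `γ₀ n`, and similar uniqueness makes the factorization a map of triangles. -/
lemma exists_triangles (hM : IsVeryGoodMetric M) {a b : ℕ ⥤ S} (f : a ⟶ b)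
    {A B C : T} {φ : A ⟶ B} {ψ : B ⟶ C} {χ : C ⟶ A⟦(1 : ℤ)⟧}
    (hT : Triangle.mk φ ψ χ ∈ distTriang T)
    {α : a ⋙ F ⟶ (Functor.const ℕ).obj A} {β : b ⋙ F ⟶ (Functor.const ℕ).obj B}
    (hf : ∀ n, F.map (f.app n) ≫ β.app n = α.app n ≫ φ)
    (hα : IsApproximation F M a.obj α.app) (hβ : IsApproximation F M b.obj β.app) :
    ∃ (τ : ℕ → ℕ) (hτ : StrictMono τ) (c : ℕ ⥤ S) (g : subseq b hτ ⟶ c)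
      (h : c ⟶ subseq a hτ ⋙ shiftFunctor S (1 : ℤ)) (γ : c ⋙ F ⟶ (Functor.const ℕ).obj C),
      (∀ n, Triangle.mk ((subseqMap f hτ).app n) (g.app n) (h.app n) ∈ distTriang S) ∧
      IsMapToTriangle F (subseqMap f hτ) g h φ ψ χ (subseqCocone α hτ) (subseqCocone β hτ) γ ∧
      IsApproximation F M c.obj γ.app := by
  choose c₀ g₀ h₀ hT₀ using fun n => distinguished_cocone_triangle (f.app n)
  have hγ₀ (n : ℕ) : ∃ γ : F.obj (c₀ n) ⟶ C, F.map (g₀ n) ≫ γ = β.app n ≫ ψ ∧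
      F.map (h₀ n) ≫ (F.commShiftIso (1 : ℤ)).hom.app (a.obj n) ≫ (α.app n)⟦(1 : ℤ)⟧' =
        γ ≫ χ := by
    obtain ⟨γ, h₁, h₂⟩ := complete_distinguished_triangle_morphism _ _
      (F.map_distinguished _ (hT₀ n)) hT (α.app n) (β.app n) (hf n)
    exact ⟨γ, h₁, (Category.assoc _ _ _).symm.trans h₂⟩
  choose γ₀ hg₀ hh₀ using hγ₀
  have hγ : IsApproximation F M c₀ γ₀ := IsApproximation.cone hM.toIsGoodMetric hT₀ hT hf hg₀ hh₀
    hα hβ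
  have hαs := hα.shift 1 hM.shift
  choose N₁ hN₁ using fun k => hγ.exists_bijective hM.exists_leftOrthogonal (b.obj k)
  choose N₂ hN₂ using fun k => hγ.exists_bijective hM.exists_leftOrthogonal (c₀ k)
  choose N₃ hN₃ using fun k => hαs.exists_bijective hM.exists_leftOrthogonal (c₀ k)
  let τ : ℕ → ℕ := fun k => Nat.rec 0
    (fun _ t => max (t + 1) (max (N₁ t) (max (N₂ t) (N₃ t)))) k
  have hτs (k : ℕ) : τ (k + 1) = max (τ k + 1) (max (N₁ (τ k)) (max (N₂ (τ k)) (N₃ (τ k)))) := rfl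
  have hτ : StrictMono τ := strictMono_nat_of_lt_succ fun k => by rw [hτs]; lia
  choose t ht using fun k => (hN₂ (τ k) (τ (k + 1)) (by rw [hτs]; lia)).2 (γ₀ (τ k))
  dsimp only at ht
  let c : ℕ ⥤ S := Functor.ofSequence t
  have hc (k : ℕ) : c.map (homOfLE k.le_succ) = t k := Functor.ofSequence_map_homOfLE_succ t k
  refine ⟨τ, hτ, c, NatTrans.ofSequence (fun k => g₀ (τ k)) (fun k => ?_),
    NatTrans.ofSequence (fun k => h₀ (τ k)) (fun k => ?_),
    NatTrans.ofSequence (fun k => γ₀ (τ k)) (fun k => ?_), fun n => hT₀ (τ n),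
    ⟨fun n => hf (τ n), fun n => hg₀ (τ n), fun n => hh₀ (τ n)⟩, hγ.comp_strictMono hτ⟩
  · apply (hN₁ (τ k) (τ (k + 1)) (by rw [hτs]; lia)).1
    have hb := map_comp_cocone_app F β (homOfLE (hτ.monotone k.le_succ))
    rw [hc]
    change F.map (b.map (homOfLE (hτ.monotone k.le_succ)) ≫ g₀ (τ (k + 1))) ≫ γ₀ (τ (k + 1)) =
      F.map (g₀ (τ k) ≫ t k) ≫ γ₀ (τ (k + 1))
    rw [F.map_comp, F.map_comp, Category.assoc, Category.assoc, hg₀, ht, hg₀, reassoc_of% hb]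
  · apply (hN₃ (τ k) (τ (k + 1)) (by rw [hτs]; lia)).1
    let a' := a.map (homOfLE (hτ.monotone k.le_succ))
    have ha : F.map a' ≫ α.app (τ (k + 1)) = α.app (τ k) := map_comp_cocone_app F α _
    have ha' : F.map (a'⟦(1 : ℤ)⟧') ≫ (F.commShiftIso (1 : ℤ)).hom.app (a.obj (τ (k + 1))) =
      (F.commShiftIso (1 : ℤ)).hom.app (a.obj (τ k)) ≫ (F.map a')⟦(1 : ℤ)⟧' :=
        (F.commShiftIso (1 : ℤ)).hom.naturality a'
    rw [hc]
    change F.map (t k ≫ h₀ (τ (k + 1))) ≫ (F.commShiftIso (1 : ℤ)).hom.app (a.obj (τ (k + 1))) ≫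
        (α.app (τ (k + 1)))⟦(1 : ℤ)⟧' =
      F.map (h₀ (τ k) ≫ a'⟦(1 : ℤ)⟧') ≫ (F.commShiftIso (1 : ℤ)).hom.app (a.obj (τ (k + 1))) ≫
        (α.app (τ (k + 1)))⟦(1 : ℤ)⟧'
    rw [F.map_comp, F.map_comp, Category.assoc, Category.assoc, hh₀, reassoc_of% ht,
      reassoc_of% ha', ← Functor.map_comp, ha, hh₀]
  · rw [Functor.comp_map, hc]
    exact (ht k).trans (Category.comp_id _).symm

/-! ### `𝔏'(S)` is a triangulated subcategory -/

lemma hocolimSubcategory_of_isApproximation (hF : IsGoodExtension F M)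
    (hM : IsVeryGoodMetric M) (hM_summands : ∀ i, (M i).IsStableUnderRetracts)
    {E : ℕ ⥤ S} {X : T} (hX : generatedBy F X) {α : E ⋙ F ⟶ (Functor.const ℕ).obj X}
    (hα : IsApproximation F M E.obj α.app) : hocolimSubcategory F M X :=
  ⟨E, α, hα.isCauchy hM hM_summands, hF.isHocolim_of_isApproximation hM hM_summands hX hα⟩

lemma hocolimSubcategory_isClosedUnderIsomorphisms (hF : IsGoodExtension F M)
    (hM : IsVeryGoodMetric M) (hM_summands : ∀ i, (M i).IsStableUnderRetracts) :
    (hocolimSubcategory F M).IsClosedUnderIsomorphisms where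
  of_iso {X X'} i := by
    rintro ⟨E, α, hE, hα⟩
    refine hocolimSubcategory_of_isApproximation hF hM hM_summands
      ((generatedBy F).prop_of_iso i (generatedBy_of_isHocolim hα))
      (α := α ≫ (Functor.const ℕ).map i.hom) fun m => ?_
    obtain ⟨N, hN⟩ := hF.isApproximation hM.toIsGoodMetric hE hα m
    refine ⟨N, fun n hn e he => ?_⟩
    convert i.homToEquiv.bijective.comp (hN n hn e he) using 1
    funext u
    simp

open ZeroObject in
lemma hocolimSubcategory_containsZero (hF : IsGoodExtension F M)
    (hM : IsVeryGoodMetric M) (hM_summands : ∀ i, (M i).IsStableUnderRetracts) :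
    (hocolimSubcategory F M).ContainsZero where
  exists_zero := by
    refine ⟨_, isZero_zero T, hocolimSubcategory_of_isApproximation hF hM hM_summands
      (E := (Functor.const ℕ).obj 0) (α := 0) (fun _ f _ => (isZero_zero T).eq_of_src _ _)
      fun _ => ⟨0, fun n _ e _ => ⟨fun x y _ => (isZero_zero S).eq_of_tgt _ _,
        fun w => ⟨0, (isZero_zero T).eq_of_tgt _ _⟩⟩⟩⟩

/-- `𝔏'(S)` is closed under cones, by lifting the morphism to a map of Cauchy sequences and
taking the sequence of cones. -/
lemma hocolimSubcategory_cone (hF : IsGoodExtension F M)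
    (hM : IsVeryGoodMetric M) (hM_summands : ∀ i, (M i).IsStableUnderRetracts)
    (D : Triangle T) (hD : D ∈ distTriang T) (h₁ : hocolimSubcategory F M D.obj₁)
    (h₂ : hocolimSubcategory F M D.obj₂) : hocolimSubcategory F M D.obj₃ := by
  obtain ⟨a, α, ha, hα⟩ := h₁
  obtain ⟨b, β, hb, hβ⟩ := h₂
  have := hF.isIso b hb _ β hβ
  obtain ⟨σ, hσ, f, hf⟩ := exists_lift_subseq F D.mor₁ α β
  obtain ⟨τ, hτ, c, g, h, γ, -, -, hγ⟩ := exists_triangles hM f hD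
    (β := subseqCocone β hσ) hf (hF.isApproximation hM.toIsGoodMetric ha hα)
    ((hF.isApproximation hM.toIsGoodMetric hb hβ).comp_strictMono hσ)
  exact hocolimSubcategory_of_isApproximation hF hM hM_summands
    ((generatedBy F).ext_of_isTriangulatedClosed₃ _ hD (generatedBy_of_isHocolim hα)
      (generatedBy_of_isHocolim hβ)) hγ

lemma hocolimSubcategory_shift_neg_one (hF : IsGoodExtension F M)
    (hM : IsVeryGoodMetric M) (hM_summands : ∀ i, (M i).IsStableUnderRetracts)
    {X : T} (hX : hocolimSubcategory F M X) : hocolimSubcategory F M (X⟦(-1 : ℤ)⟧) := by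
  obtain ⟨E, α, hE, hα⟩ := hX
  let α' : (E ⋙ shiftFunctor S (-1 : ℤ)) ⋙ F ⟶ (Functor.const ℕ).obj (X⟦(-1 : ℤ)⟧) :=
    { app n := (F.commShiftIso (-1 : ℤ)).hom.app (E.obj n) ≫ (α.app n)⟦(-1 : ℤ)⟧'
      naturality m n f := by
        have h := (F.commShiftIso (-1 : ℤ)).hom.naturality (E.map f)
        simp only [Functor.comp_map] at h
        refine Eq.trans ?_ (Category.comp_id _).symm
        simp only [Functor.comp_map]
        rw [reassoc_of% h, ← Functor.map_comp, map_comp_cocone_app] }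
  exact hocolimSubcategory_of_isApproximation hF hM hM_summands
    ((generatedBy F).le_shift (-1 : ℤ) X (generatedBy_of_isHocolim hα)) (α := α')
    ((hF.isApproximation hM.toIsGoodMetric hE hα).shift (-1) hM.shift_neg)

open ZeroObject in
/-- Stability under `Σ⁻¹` and under cones suffices: `ΣX` is the cone of `X ⟶ 0`. -/
lemma hocolimSubcategory_isTriangulated (hF : IsGoodExtension F M)
    (hM : IsVeryGoodMetric M) (hM_summands : ∀ i, (M i).IsStableUnderRetracts) :
    (hocolimSubcategory F M).IsTriangulated := by
  have := hocolimSubcategory_isClosedUnderIsomorphisms hF hM hM_summands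
  have := hocolimSubcategory_containsZero hF hM hM_summands
  have hneg (X : T) (hX : hocolimSubcategory F M X) : hocolimSubcategory F M (X⟦(-1 : ℤ)⟧) :=
    hocolimSubcategory_shift_neg_one hF hM hM_summands hX
  have hpos (X : T) (hX : hocolimSubcategory F M X) : hocolimSubcategory F M (X⟦(1 : ℤ)⟧) :=
    hocolimSubcategory_cone hF hM hM_summands _
      (rot_of_distTriang _ (contractible_distinguished X)) hX
      ((hocolimSubcategory F M).prop_of_isZero (isZero_zero T))
  have hshift (n : ℤ) (X : T) (hX : hocolimSubcategory F M X) :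
      hocolimSubcategory F M (X⟦n⟧) := by
    induction n with
    | zero =>
      exact (hocolimSubcategory F M).prop_of_iso ((shiftFunctorZero T ℤ).app X).symm hX
    | succ n hn =>
      exact (hocolimSubcategory F M).prop_of_iso
        ((shiftFunctorAdd' T (n : ℤ) 1 (n + 1) rfl).app X).symm (hpos _ hn)
    | pred n hn =>
      exact (hocolimSubcategory F M).prop_of_iso
        ((shiftFunctorAdd' T (-(n : ℤ)) (-1) (-n - 1) rfl).app X).symm (hneg _ hn)
  have : (hocolimSubcategory F M).IsStableUnderShift ℤ := ⟨fun n => ⟨hshift n⟩⟩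
  have : (hocolimSubcategory F M).IsTriangulatedClosed₃ :=
    .mk' fun D hD h₁ h₂ => hocolimSubcategory_cone hF hM hM_summands D hD h₁ h₂
  have : (hocolimSubcategory F M).IsTriangulatedClosed₂ := .of_isTriangulatedClosed₃
  constructor

end Extension

end MetricTriangulated

theorem proposition5
    {S : Type u} [Category.{v} S] [Preadditive S] [HasZeroObject S] [HasShift S ℤ]
    [∀ n : ℤ, (shiftFunctor S n).Additive] [Pretriangulated S] [IsTriangulated S]
    {T : Type u'} [Category.{v} T] [Preadditive T] [HasZeroObject T] [HasShift T ℤ]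
    [∀ n : ℤ, (shiftFunctor T n).Additive] [Pretriangulated T] [IsTriangulated T]
    (F : S ⥤ T) [F.CommShift ℤ] [F.IsTriangulated]
    (M : ℕ → ObjectProperty S)
    (hM : MetricTriangulated.IsVeryGoodMetric M)
    (hM_summands : ∀ i, (M i).IsStableUnderRetracts)
    (hF : MetricTriangulated.IsGoodExtension F M) :
    -- the subcategory `𝔏'(S)` is a (strictly full) triangulated subcategory of `T`
    (MetricTriangulated.hocolimSubcategory F M).IsTriangulated ∧
    (MetricTriangulated.hocolimSubcategory F M).IsClosedUnderIsomorphisms ∧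
    -- given a morphism `φ : A ⟶ B` and Cauchy sequences with homotopy colimits `A` and `B`
    ∀ (A B : T) (φ : A ⟶ B) (a b : ℕ ⥤ S)
      (α : a ⋙ F ⟶ (Functor.const ℕ).obj A) (β : b ⋙ F ⟶ (Functor.const ℕ).obj B),
      MetricTriangulated.IsCauchy M a → MetricTriangulated.IsCauchy M b →
      MetricTriangulated.IsHocolim (a ⋙ F) α → MetricTriangulated.IsHocolim (b ⋙ F) β →
      -- after passing to subsequences, `φ` lifts to a map of Cauchy sequences
      (∃ (ρ σ : ℕ → ℕ) (hρ : StrictMono ρ) (hσ : StrictMono σ)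
        (f : MetricTriangulated.subseq a hρ ⟶ MetricTriangulated.subseq b hσ),
        MetricTriangulated.ColimYonedaEq F (MetricTriangulated.subseqCocone α hρ)
          (MetricTriangulated.subseqCocone β hσ) f φ) ∧
      -- and for every such lift `f` and every triangle on `φ`
      ∀ (ρ σ : ℕ → ℕ) (hρ : StrictMono ρ) (hσ : StrictMono σ)
        (f : MetricTriangulated.subseq a hρ ⟶ MetricTriangulated.subseq b hσ),
        MetricTriangulated.ColimYonedaEq F (MetricTriangulated.subseqCocone α hρ)
          (MetricTriangulated.subseqCocone β hσ) f φ →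
        ∀ (C : T) (ψ : B ⟶ C) (χ : C ⟶ A⟦(1 : ℤ)⟧), Triangle.mk φ ψ χ ∈ distTriang T →
          -- after passing to a further subsequence, `f` extends to a sequence of triangles
          ∃ (τ : ℕ → ℕ) (hτ : StrictMono τ) (c : ℕ ⥤ S)
            (g : MetricTriangulated.subseq (MetricTriangulated.subseq b hσ) hτ ⟶ c)
            (h : c ⟶ MetricTriangulated.subseq (MetricTriangulated.subseq a hρ) hτ ⋙
              shiftFunctor S (1 : ℤ))
            (γ : c ⋙ F ⟶ (Functor.const ℕ).obj C),
            MetricTriangulated.IsCauchySeqOfTriangles M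
              (MetricTriangulated.subseqMap f hτ) g h ∧
            MetricTriangulated.IsMapToTriangle F (MetricTriangulated.subseqMap f hτ) g h φ ψ χ
              (MetricTriangulated.subseqCocone (MetricTriangulated.subseqCocone α hρ) hτ)
              (MetricTriangulated.subseqCocone (MetricTriangulated.subseqCocone β hσ) hτ) γ ∧
            MetricTriangulated.IsHocolim (c ⋙ F) γ ∧
            MetricTriangulated.IsIsoToYoneda F (MetricTriangulated.subseqMap f hτ) g h φ ψ χ
              (MetricTriangulated.subseqCocone (MetricTriangulated.subseqCocone α hρ) hτ)
              (MetricTriangulated.subseqCocone (MetricTriangulated.subseqCocone β hσ) hτ) γ := by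
  refine ⟨MetricTriangulated.hocolimSubcategory_isTriangulated hF hM hM_summands,
    MetricTriangulated.hocolimSubcategory_isClosedUnderIsomorphisms hF hM hM_summands, ?_⟩
  intro A B φ a b α β ha hb hα hβ
  have hα' := hF.isApproximation hM.toIsGoodMetric ha hα
  have hβ' := hF.isApproximation hM.toIsGoodMetric hb hβ
  refine ⟨?_, ?_⟩
  · have := hF.isIso b hb B β hβ
    obtain ⟨σ, hσ, f, hf⟩ := MetricTriangulated.exists_lift_subseq F φ α β
    exact ⟨id, σ, strictMono_id, hσ, f, (MetricTriangulated.colimYonedaEq_iff F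
      (MetricTriangulated.subseqCocone α strictMono_id)
      (MetricTriangulated.subseqCocone β hσ) f φ).2 hf⟩
  · intro ρ σ hρ hσ f hf C ψ χ hT
    obtain ⟨τ, hτ, c, g, h, γ, hdist, hmap, hγ⟩ := MetricTriangulated.exists_triangles hM f hT
      ((MetricTriangulated.colimYonedaEq_iff F _ _ f φ).1 hf)
      (hα'.comp_strictMono hρ) (hβ'.comp_strictMono hσ)
    have hα₁ : MetricTriangulated.IsApproximation F M _ (MetricTriangulated.subseqCocone
        (MetricTriangulated.subseqCocone α hρ) hτ).app :=
      (hα'.comp_strictMono hρ).comp_strictMono hτ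
    have hβ₁ : MetricTriangulated.IsApproximation F M _ (MetricTriangulated.subseqCocone
        (MetricTriangulated.subseqCocone β hσ) hτ).app :=
      (hβ'.comp_strictMono hσ).comp_strictMono hτ
    have hα₂ : MetricTriangulated.IsApproximation F M _ (MetricTriangulated.shiftCocone F
        (MetricTriangulated.subseqCocone (MetricTriangulated.subseqCocone α hρ) hτ)).app :=
      hα₁.shift 1 hM.shift
    have hC : MetricTriangulated.generatedBy F C :=
      (MetricTriangulated.generatedBy F).ext_of_isTriangulatedClosed₃ _ hT
        (MetricTriangulated.generatedBy_of_isHocolim hα)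
        (MetricTriangulated.generatedBy_of_isHocolim hβ)
    exact ⟨τ, hτ, c, g, h, γ,
      ⟨hα₁.isCauchy hM hM_summands, hβ₁.isCauchy hM hM_summands, hγ.isCauchy hM hM_summands,
        hdist⟩, hmap, hF.isHocolim_of_isApproximation hM hM_summands hC hγ,
      ⟨hα₁.isIso_colimYonedaDesc hM.exists_leftOrthogonal,
        hβ₁.isIso_colimYonedaDesc hM.exists_leftOrthogonal,
        hγ.isIso_colimYonedaDesc hM.exists_leftOrthogonal,
        hα₂.isIso_colimYonedaDesc hM.exists_leftOrthogonal,
        (MetricTriangulated.colimYonedaEq_iff F _ _ _ _).2 hmap.comm₁,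
        (MetricTriangulated.colimYonedaEq_iff F _ _ _ _).2 hmap.comm₂,
        (MetricTriangulated.colimYonedaEq_iff F _ _ _ _).2 hmap.comm₃⟩⟩
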